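/- Consider a finite game in normal form: a finite set of players $i\in\mathcal N$, where player $i$ has the actions $\mathcal A_i=\{0,1,\dots,m_i\}$ and the payoff function $u_i:\mathcal A=\prod_j\mathcal A_j\to\mathbb R$. Extend $u_i$ to mixed strategy profiles by $u_i(x)=\sum_{\alpha\in\mathcal A}u_i(\alpha)\prod_j x_{j\alpha_j}$, put $v_{i\alpha}(x)=u_i(\alpha;x_{-i})$ for $\alpha\in\mathcal A_i$, and let $\mathcal X^\circ=\prod_i\{x_i\in\mathbb R_{>0}^{m_i+1}:\sum_\alpha x_{i\alpha}=1\}$ be the space of interior strategy profiles. The replicator dynamics on $\mathcal X^\circ$ are $$\dot x_{i\alpha}=x_{i\alpha}\bigl[u_i(\alpha;x_{-i})-u_i(x)\bigr]\qquad(i\in\mathcal N,\ \alpha\in\mathcal A_i).$$ Use the coordinates $y=\pi(x)$, $y_{ia}=x_{ia}$ for $a=1,\dots,m_i$ (so $x_{i0}=1-\sum_{a}y_{ia}$), which identify $\mathcal X^\circ$ with the open set $\mathcal C^\circ=\prod_i\{y_i\in\mathbb R_{>0}^{m_i}:\sum_a y_{ia}<1\}$. In these coordinates the Shahshahani metric of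 player $i$ has the matrix $g_i(y_i)_{ab}=\delta_{ab}/x_{ia}+1/x_{i0}$, the metric on $\mathcal C^\circ$ is the product metric $g(y)=\operatorname{diag}(g_i(y_i))_i$, and the replicator field is $$V_{ia}(y)=y_{ia}\Bigl[\tilde v_{ia}(y)-\sum_{b=1}^{m_i}y_{ib}\tilde v_{ib}(y)\Bigr],\qquad \tilde v_{ia}(y)=v_{ia}(x)-v_{i0}(x).$$ The game is called incompressible if, for all $y\in\mathcal C^\circ$, $$\sum_{i\in\mathcal N}\frac1{\sqrt{\det g_i(y_i)}}\sum_{a=1}^{m_i}\frac{\partial}{\partial y_{ia}}\Bigl(\sqrt{\det g_i(y_i)}\;V_{ia}(y)\Bigr)=0 .$$ The Shahshahani volume of $B\subseteq\mathcal X^\circ$ is $\operatorname{vol}(B)=\int_{\pi(B)}\sqrt{\det g(y)}\,dy\in[0,\infty]$. **Proposition.** If a finite game is incompressible, then its replicator dynamics preserve the Shahshahani volume. That is, the replicator dynamics have a unique global flow $\Phi:\mathbb R\times\mathcal X^\circ\to\mathcal X^\circ$ (for each $x\in\mathcal X^\circ$ the curve $t\mapsto\Phi_t(x)$ is the solution,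 defined for all $t\in\mathbb R$, that starts at $x$), and $$\operatorname{vol}(\Phi_t(B))=\operatorname{vol}(B)$$ for every open set $B\subseteq\mathcal X^\circ$ and every $t\in\mathbb R$. -/

import Mathlib

/-- A finite game in normal form. The players are the elements of the finite type `ι`, player `i`
has the actions `0, 1, …, m i`, and `payoff i α` is the payoff of player `i` at the pure action
profile `α`. -/
structure FiniteGame {ι : Type*} (m : ι → ℕ) where
  payoff : ι → (∀ j, Fin (m j + 1)) → ℝ

namespace FiniteGame

noncomputable section

/-! ### Strategies -/

/-- The ambient space of strategy profiles, `∏ i, ℝ ^ (m i + 1)`. -/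
abbrev Profile {ι : Type*} (m : ι → ℕ) : Type _ := ∀ i, Fin (m i + 1) → ℝ

/-- The space `∏ i, ℝ ^ (m i)` of effective (corner-of-cube) coordinates. -/
abbrev EffProfile {ι : Type*} (m : ι → ℕ) : Type _ := ∀ i, Fin (m i) → ℝ

/-- The interior mixed strategy profiles: each player's mixed strategy lies in the open unit
simplex. As a subtype it carries the subspace topology. -/
abbrev IntStrategies {ι : Type*} (m : ι → ℕ) : Type _ :=
  {x : Profile m // ∀ i, (∀ a, 0 < x i a) ∧ ∑ a, x i a = 1}

/-- The product of the open corners of cubes. -/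
def openCorner {ι : Type*} (m : ι → ℕ) : Set (EffProfile m) :=
  {y | ∀ i, (∀ a, 0 < y i a) ∧ ∑ a, y i a < 1}

/-- The chart that forgets the `0`-th coordinate of each player. -/
def toEff {ι : Type*} {m : ι → ℕ} (x : Profile m) : EffProfile m :=
  fun i a => x i a.succ

/-- Recover a mixed strategy from its effective coordinates, `x₀ = 1 - ∑ a, y a`. -/
def ofEffPlayer {n : ℕ} (y : Fin n → ℝ) : Fin (n + 1) → ℝ :=
  Fin.cons (1 - ∑ a, y a) y

/-- The inverse of the chart, player by player. -/
def ofEff {ι : Type*} {m : ι → ℕ} (y : EffProfile m) : Profile m :=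
  fun i => ofEffPlayer (y i)

/-! ### Payoffs and the replicator field -/

section Payoffs

variable {ι : Type*} [Fintype ι] [DecidableEq ι] {m : ι → ℕ}

/-- The mixed payoff `u_i(x) = ∑ α, u_i(α) ∏ j, x_{j, α_j}`. -/
def mixedPayoff (G : FiniteGame m) (i : ι) (x : Profile m) : ℝ :=
  ∑ α : (∀ j, Fin (m j + 1)), G.payoff i α * ∏ j, x j (α j)

/-- The payoff field `v_{i, a}(x) = u_i(a; x_{-i})`, where the action `a` is identified with the
mixed strategy that assigns all weight to it. -/
def payoffField (G : FiniteGame m) (x : Profile m) (i : ι) (a : Fin (m i + 1)) : ℝ :=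
  G.mixedPayoff i (Function.update x i (Pi.single a 1))

/-- The replicator vector field `x_{i, a} [u_i(a; x_{-i}) - u_i(x)]`. -/
def replicatorField (G : FiniteGame m) (x : Profile m) : Profile m :=
  fun i a => x i a * (G.payoffField x i a - G.mixedPayoff i x)

/-- The effective payoff field `v_{i, a}(x) - v_{i, 0}(x)`, for `a = 1, …, m i`. -/
def effPayoffField (G : FiniteGame m) (y : EffProfile m) (i : ι) (a : Fin (m i)) : ℝ :=
  G.payoffField (ofEff y) i a.succ - G.payoffField (ofEff y) i 0

/-- The replicator field in effective coordinates. -/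
def effReplicatorField (G : FiniteGame m) (y : EffProfile m) : EffProfile m :=
  fun i a => y i a * (G.effPayoffField y i a - ∑ b, y i b * G.effPayoffField y i b)

end Payoffs

/-! ### The Shahshahani metric, its volume and its divergence -/

/-- The Shahshahani inner product `∑ a, v_a w_a / x_a` at a point `x` of the positive orthant. -/
def shahshahaniInner {n : ℕ} (x v w : Fin n → ℝ) : ℝ :=
  ∑ a, v a * w a / x a

/-- The vector `e_a - e_0` tangent to the simplex that corresponds to the `a`-th standard basis
vector of the effective coordinates. -/
def effBasisVec {n : ℕ} (a : Fin n) : Fin (n + 1) → ℝ :=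
  Pi.single a.succ 1 - Pi.single 0 1

/-- The matrix of the Shahshahani metric of one player in effective coordinates. -/
def playerMetric {n : ℕ} (y : Fin n → ℝ) : Matrix (Fin n) (Fin n) ℝ :=
  Matrix.of fun a b => shahshahaniInner (ofEffPlayer y) (effBasisVec a) (effBasisVec b)

section Geometry

variable {ι : Type*} [Fintype ι] [DecidableEq ι] {m : ι → ℕ}

/-- The matrix, in effective coordinates, of the product of the players' Shahshahani metrics. -/
def effMetric (y : EffProfile m) : Matrix (Σ i, Fin (m i)) (Σ i, Fin (m i)) ℝ :=
  Matrix.blockDiagonal' fun i => playerMetric (y i)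

/-- The Shahshahani volume of a set of interior strategy profiles: the Lebesgue integral of
`√(det g)` over the image of the set in effective coordinates. -/
def shahshahaniVolume (B : Set (IntStrategies m)) : ENNReal :=
  ∫⁻ y in (fun x : IntStrategies m => toEff x.1) '' B,
    ENNReal.ofReal (Real.sqrt (effMetric y).det)

/-- The Shahshahani divergence, with respect to the variables of player `i`, of the `i`-th
component of a vector field `V` in effective coordinates:
`(1 / √(det g_i)) ∑ a, ∂/∂y_{i, a} (√(det g_i) V_{i, a})`. -/
def playerDivergence (V : EffProfile m → EffProfile m) (i : ι) (y : EffProfile m) : ℝ :=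
  1 / Real.sqrt (playerMetric (y i)).det *
    ∑ a, lineDeriv ℝ (fun z : EffProfile m => Real.sqrt (playerMetric (z i)).det * V z i a) y
      (Pi.single i (Pi.single a 1))

/-- A game is incompressible if the Shahshahani divergence of its replicator field vanishes
on the whole open corner of cube. -/
def IsIncompressible (G : FiniteGame m) : Prop :=
  ∀ y ∈ openCorner m, ∑ i, playerDivergence G.effReplicatorField i y = 0

/-- `Φ` is the global flow of the replicator dynamics on the interior strategy profiles: for each
`x`, the curve `t ↦ Φ t x` is defined for all times, starts at `x` and solves the dynamics. -/
structure IsReplicatorFlow (G : FiniteGame m)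
    (Φ : ℝ → IntStrategies m → IntStrategies m) : Prop where
  start : ∀ x, Φ 0 x = x
  solves : ∀ x t, HasDerivAt (fun s => (Φ s x).1) (G.replicatorField (Φ t x).1) t

end Geometry

end

end FiniteGame

/-! ### Global flows of bounded Lipschitz vector fields -/

section GlobalFlow

open Set Filter Topology
open scoped NNReal

variable {E : Type*} [NormedAddCommGroup E] [NormedSpace ℝ E]

/-! In the log-ratio coordinates `z_{ia} = log (x_{ia} / x_{i0})` the replicator field becomes
`v_{ia} - v_{i0}`, since the mean payoff cancels. This field is bounded and Lipschitz, so it has a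
unique global flow. Its `i`-th block does not depend on `z_i`, because `u_i(a; x_{-i})` ignores the
strategy of player `i`; hence the flow preserves Lebesgue measure `dz`, for every game
(`IsGlobalFlow.measurePreserving`). The Jacobian of `y ↦ z` is the metric `g` itself, with `det g =
1 / P` where `P` is the product of all `x_{ia}`. The Shahshahani volume is therefore `√P dz`
(`shahshahaniVolume_eq_setLIntegral`). The divergence of the replicator field equals half the
derivative of `log P` along the dynamics (`playerDivergence_effReplicatorField`), so
incompressibility makes `P` a constant of motion. Measure and density are then both invariant.
Invariance of `dz` is proved without differentiating the flow: the flow is a limit of compositions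
of shears, and each shear preserves volume by Fubini and translation invariance. -/

/-- `φ` is the global flow of the autonomous vector field `F`. -/
structure IsGlobalFlow (F : E → E) (φ : ℝ → E → E) : Prop where
  start : ∀ x, φ 0 x = x
  solves : ∀ x t, HasDerivAt (fun s => φ s x) (F (φ t x)) t

/-- A bounded Lipschitz vector field has an integral curve on every interval `(-T, T)`. -/
theorem exists_integralCurve_Ioo_of_bounded_lipschitz [CompleteSpace E] {F : E → E} {K L : ℝ≥0}
    (hK : ∀ x, ‖F x‖ ≤ K) (hL : LipschitzWith L F) (x : E) (T : ℝ≥0) :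
    ∃ γ : ℝ → E, γ 0 = x ∧ ∀ t ∈ Ioo (-T : ℝ) T, HasDerivAt γ (F (γ t)) t := by
  have h0 : (0 : ℝ) ∈ Icc (-T : ℝ) T := ⟨by simp, T.2⟩
  -- A curve of speed at most `K` travels at most `K * T` in time `T`; as the bound on `F` is
  -- global, a ball of that radius works for every `T`.
  have hp : IsPicardLindelof (fun _ => F) (⟨0, h0⟩ : Icc (-T : ℝ) T) x (K * T) 0 K L :=
    { lipschitzOnWith := fun _ _ => hL.lipschitzOnWith
      continuousOn := fun _ _ => continuousOn_const
      norm_le := fun _ _ y _ => hK y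
      mul_max_le := by simp }
  obtain ⟨γ, h1, h2⟩ := hp.exists_eq_forall_mem_Icc_hasDerivWithinAt₀
  exact ⟨γ, h1, fun t ht =>
    (h2 t (Ioo_subset_Icc_self ht)).hasDerivAt (Icc_mem_nhds ht.1 ht.2)⟩

/-- Uniqueness makes the curves on nested intervals agree, so they glue to one curve on `ℝ`. -/
theorem exists_integralCurve_of_bounded_lipschitz [CompleteSpace E] {F : E → E} {K L : ℝ≥0}
    (hK : ∀ x, ‖F x‖ ≤ K) (hL : LipschitzWith L F) (x : E) :
    ∃ γ : ℝ → E, γ 0 = x ∧ ∀ t, HasDerivAt γ (F (γ t)) t := by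
  choose γ h0 h1 using exists_integralCurve_Ioo_of_bounded_lipschitz hK hL x
  have key : ∀ (S T : ℝ≥0) (t : ℝ), |t| < S → S ≤ T → γ S t = γ T t := by
    intro S T t ht hST
    have hS : (0 : ℝ) < S := (abs_nonneg t).trans_lt ht
    have hST' : (S : ℝ) ≤ T := hST
    refine ODE_solution_unique_of_mem_Ioo (v := fun _ => F) (s := fun _ => univ) (K := L)
      (t₀ := 0) (a := -(S : ℝ)) (b := S)
      (fun _ _ => hL.lipschitzOnWith) ⟨by linarith, hS⟩
      (fun s hs => ⟨h1 S s hs, trivial⟩)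
      (fun s hs => ⟨h1 T s ⟨by linarith [hs.1], by linarith [hs.2]⟩, trivial⟩)
      (by rw [h0, h0]) (abs_lt.1 ht)
  -- The interval used varies with `t`; near a given `t` all choices agree with the single curve of
  -- radius `|t| + 2`, which can be differentiated.
  refine ⟨fun t => γ (‖t‖₊ + 1) t, h0 _, fun t => ?_⟩
  have hmem : t ∈ Ioo (-((‖t‖₊ + 2 : ℝ≥0) : ℝ)) ((‖t‖₊ + 2 : ℝ≥0) : ℝ) :=
    abs_lt.1 (by simp)
  have := h1 (‖t‖₊ + 2) t hmem
  have hev : (fun s => γ (‖s‖₊ + 1) s) =ᶠ[𝓝 t] γ (‖t‖₊ + 2) := by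
    have : ∀ᶠ s in 𝓝 t, |s| < |t| + 1 :=
      continuous_abs.continuousAt.eventually_lt continuousAt_const (by simp)
    filter_upwards [this] with s hs
    refine key _ _ s (by simp) ?_
    rw [← NNReal.coe_le_coe]
    simp only [NNReal.coe_add, coe_nnnorm, Real.norm_eq_abs, NNReal.coe_one, NNReal.coe_ofNat]
    linarith
  have he : γ (‖t‖₊ + 1) t = γ (‖t‖₊ + 2) t := hev.eq_of_nhds
  simp only [he]
  exact this.congr_of_eventuallyEq hev

theorem exists_isGlobalFlow_of_bounded_lipschitz [CompleteSpace E] {F : E → E} {K L : ℝ≥0}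
    (hK : ∀ x, ‖F x‖ ≤ K) (hL : LipschitzWith L F) : ∃ φ, IsGlobalFlow F φ := by
  choose γ h0 h1 using exists_integralCurve_of_bounded_lipschitz hK hL
  exact ⟨fun t x => γ x t, h0, h1⟩

theorem integralCurve_eq_of_lipschitz {F : E → E} {L : ℝ≥0} (hL : LipschitzWith L F)
    {γ δ : ℝ → E} (hγ : ∀ t, HasDerivAt γ (F (γ t)) t) (hδ : ∀ t, HasDerivAt δ (F (δ t)) t)
    (h : γ 0 = δ 0) : γ = δ :=
  ODE_solution_unique_univ (v := fun _ => F) (s := fun _ => univ) (K := L) (t₀ := 0)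
    (fun _ => hL.lipschitzOnWith) (fun t => ⟨hγ t, trivial⟩) (fun t => ⟨hδ t, trivial⟩) h

namespace IsGlobalFlow

variable {F : E → E} {φ : ℝ → E → E} {K L : ℝ≥0}

theorem neg (h : IsGlobalFlow F φ) : IsGlobalFlow (fun x => -F x) (fun t => φ (-t)) where
  start x := by simpa using h.start x
  solves x t := by
    simpa [Function.comp_def] using (h.solves x (-t)).scomp t (hasDerivAt_neg t)

theorem add_apply (h : IsGlobalFlow F φ) (hL : LipschitzWith L F) (s t : ℝ) (x : E) :
    φ (s + t) x = φ s (φ t x) := by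
  refine congrFun (integralCurve_eq_of_lipschitz hL (γ := fun s => φ (s + t) x)
    (δ := fun s => φ s (φ t x)) (fun s => ?_) (h.solves _) ?_) s
  · exact (h.solves x (s + t)).comp_add_const s t
  · simp [h.start]

/-- Grönwall: the time-`t` map is Lipschitz with constant `exp (L * t)`. -/
theorem continuous_of_nonneg (h : IsGlobalFlow F φ) (hL : LipschitzWith L F) {t : ℝ}
    (ht : 0 ≤ t) : Continuous (φ t) := by
  refine LipschitzWith.continuous (K := ⟨Real.exp (L * t), (Real.exp_pos _).le⟩)
    (LipschitzWith.of_dist_le_mul fun x y => ?_)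
  have := dist_le_of_trajectories_ODE (v := fun _ => F) (K := L) (a := 0) (b := t)
    (f := fun s => φ s x) (g := fun s => φ s y) (δ := dist x y) (fun _ => hL)
    (fun s _ => (h.solves x s).continuousAt.continuousWithinAt)
    (fun s _ => (h.solves x s).hasDerivWithinAt)
    (fun s _ => (h.solves y s).continuousAt.continuousWithinAt)
    (fun s _ => (h.solves y s).hasDerivWithinAt) (by simp [h.start]) t ⟨ht, le_rfl⟩
  rw [mul_comm]
  exact this.trans_eq (by rw [sub_zero]; rfl)

theorem continuous (h : IsGlobalFlow F φ) (hL : LipschitzWith L F) (t : ℝ) :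
    Continuous (φ t) := by
  rcases le_total 0 t with ht | ht
  · exact h.continuous_of_nonneg hL ht
  · simpa using h.neg.continuous_of_nonneg hL.neg (neg_nonneg.2 ht)

/-- The time-`t` map of the flow of a Lipschitz field. -/
def homeomorph (h : IsGlobalFlow F φ) (hL : LipschitzWith L F) (t : ℝ) : E ≃ₜ E where
  toFun := φ t
  invFun := φ (-t)
  left_inv x := by rw [← h.add_apply hL]; simp [h.start]
  right_inv x := by rw [← h.add_apply hL]; simp [h.start]
  continuous_toFun := h.continuous hL t
  continuous_invFun := h.continuous hL (-t)

theorem norm_sub_le (h : IsGlobalFlow F φ) (hK : ∀ x, ‖F x‖ ≤ K) (s t : ℝ) (x : E) :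
    ‖φ t x - φ s x‖ ≤ K * |t - s| := by
  simpa using convex_univ.norm_image_sub_le_of_norm_hasDerivWithin_le (x := s) (y := t)
    (fun u _ => (h.solves x u).hasDerivWithinAt) (fun u _ => hK _) trivial trivial

/-- The Euler step of a bounded Lipschitz field is accurate to second order. -/
theorem norm_sub_euler_le (h : IsGlobalFlow F φ) (hK : ∀ x, ‖F x‖ ≤ K) (hL : LipschitzWith L F)
    {t : ℝ} (ht : 0 ≤ t) (x : E) : ‖φ t x - (x + t • F x)‖ ≤ L * K * t ^ 2 := by
  have hd : ∀ u ∈ Icc 0 t, HasDerivWithinAt (fun u => φ u x - u • F x)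
      (F (φ u x) - F x) (Icc 0 t) u := fun u _ => by
    simpa [Pi.sub_def] using ((h.solves x u).sub ((hasDerivAt_id u).smul_const (F x))).hasDerivWithinAt
  have hb : ∀ u ∈ Icc 0 t, ‖F (φ u x) - F x‖ ≤ L * K * t := fun u hu => by
    calc ‖F (φ u x) - F x‖ ≤ L * ‖φ u x - x‖ := hL.norm_sub_le _ _
      _ ≤ L * (K * t) := by
        gcongr
        have := h.norm_sub_le hK 0 u x
        rw [h.start, sub_zero, abs_of_nonneg hu.1] at this
        exact this.trans (by gcongr; exact hu.2)
      _ = _ := by ring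
  have := (convex_Icc 0 t).norm_image_sub_le_of_norm_hasDerivWithin_le hd hb
    (left_mem_Icc.2 ht) (right_mem_Icc.2 ht)
  simp only [h.start, zero_smul, sub_zero, Real.norm_eq_abs, abs_of_nonneg ht] at this
  calc ‖φ t x - (x + t • F x)‖ = ‖φ t x - t • F x - x‖ := by congr 1; abel
    _ ≤ _ := this
    _ = _ := by ring

/-- The iterates of a one-step method that is accurate to second order stay close to the flow. -/
theorem norm_iterate_sub_le (h : IsGlobalFlow F φ) (hK : ∀ x, ‖F x‖ ≤ K)
    (hL : LipschitzWith L F) {S : E → E} {C t : ℝ} (ht : 0 ≤ t)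
    (hS : ∀ x, ‖S x - (x + t • F x)‖ ≤ C * t ^ 2) (x : E) (n : ℕ) :
    ‖S^[n] x - φ (n * t) x‖ ≤ n * ((C + L * K) * t ^ 2) * Real.exp (L * (n * t)) := by
  have hC : 0 ≤ (C + L * K) * t ^ 2 := by
    have := (norm_nonneg _).trans (hS x)
    have : 0 ≤ (L : ℝ) * K * t ^ 2 := by positivity
    linarith
  induction n with
  | zero => simp [h.start]
  | succ n ih =>
    set p := S^[n] x
    set q := φ (n * t) x
    have e1 : S^[n + 1] x = S p := Function.iterate_succ_apply' S n x
    have e2 : φ ((n + 1 : ℕ) * t) x = φ t q := by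
      rw [← h.add_apply hL]; push_cast; congr 1; ring
    -- The new error consists of the local error of `S` at `p`, the local error of the Euler step at
    -- `q`, and the old error `p - q` carried through one Euler step.
    have e3 : S p - φ t q = (S p - (p + t • F p)) - (φ t q - (q + t • F q))
        + ((p - q) + t • (F p - F q)) := by rw [smul_sub]; abel
    have hpq : ‖(p - q) + t • (F p - F q)‖ ≤ (1 + L * t) * ‖p - q‖ := by
      refine (norm_add_le _ _).trans ?_
      rw [norm_smul, Real.norm_of_nonneg ht]
      nlinarith [hL.norm_sub_le p q]
    have hexp : 1 + L * t ≤ Real.exp (L * t) := by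
      linarith [Real.add_one_le_exp (L * t : ℝ)]
    have h1 : (1 : ℝ) ≤ Real.exp (L * ((n + 1 : ℕ) * t)) := Real.one_le_exp (by positivity)
    rw [e1, e2, e3]
    calc _ ≤ ‖S p - (p + t • F p)‖ + ‖φ t q - (q + t • F q)‖
          + ‖(p - q) + t • (F p - F q)‖ :=
          (norm_add_le _ _).trans (by gcongr; exact _root_.norm_sub_le _ _)
      _ ≤ C * t ^ 2 + L * K * t ^ 2 + Real.exp (L * t) *
          (n * ((C + L * K) * t ^ 2) * Real.exp (L * (n * t))) := by
          refine add_le_add (add_le_add (hS p) (h.norm_sub_euler_le hK hL ht q)) (hpq.trans ?_)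
          gcongr
      _ = (C + L * K) * t ^ 2 + n * ((C + L * K) * t ^ 2) *
          Real.exp (L * ((n + 1 : ℕ) * t)) := by
          have : Real.exp (L * ((n + 1 : ℕ) * t)) =
              Real.exp (L * t) * Real.exp (L * (n * t)) := by
            rw [← Real.exp_add]; push_cast; congr 1; ring
          rw [this]; ring
      _ ≤ _ := by
          push_cast at h1 ⊢
          nlinarith

/-- A one-step method that is accurate to second order converges to the flow. -/
theorem tendsto_iterate (h : IsGlobalFlow F φ) (hK : ∀ x, ‖F x‖ ≤ K) (hL : LipschitzWith L F)
    {S : ℝ → E → E} {C : ℝ} (hS : ∀ s, 0 ≤ s → ∀ x, ‖S s x - (x + s • F x)‖ ≤ C * s ^ 2)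
    {t : ℝ} (ht : 0 ≤ t) (x : E) :
    Tendsto (fun n : ℕ => (S (t / n))^[n] x) atTop (𝓝 (φ t x)) := by
  rw [tendsto_iff_norm_sub_tendsto_zero]
  -- Taking `n` steps of length `t / n`, each with error of order `(t / n) ^ 2`, leaves a total
  -- error of order `1 / n`.
  have hlim : Tendsto (fun n : ℕ => (C + L * K) * t ^ 2 * Real.exp (L * t) / n) atTop (𝓝 0) :=
    tendsto_const_div_atTop_nhds_zero_nat _
  refine squeeze_zero' (Eventually.of_forall fun _ => norm_nonneg _) ?_ hlim
  filter_upwards [eventually_gt_atTop 0] with n hn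
  have hn' : (n : ℝ) ≠ 0 := by positivity
  have := h.norm_iterate_sub_le hK hL (S := S (t / n)) (t := t / n) (by positivity)
    (hS _ (by positivity)) x n
  rw [mul_div_cancel₀ t hn'] at this
  refine this.trans_eq ?_
  field_simp

end IsGlobalFlow

end GlobalFlow

/-! ### Volume preservation for fields whose components do not depend on their own variable -/

section Shear

open Set Filter Topology MeasureTheory
open scoped NNReal

variable {ι : Type*} [DecidableEq ι] {E : ι → Type*}
  [∀ i, NormedAddCommGroup (E i)] [∀ i, NormedSpace ℝ (E i)]

/-- The Euler step of length `h` along the `i`-th component of `F`. -/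
def shear (F : (∀ i, E i) → ∀ i, E i) (h : ℝ) (i : ι) (z : ∀ i, E i) : ∀ i, E i :=
  Function.update z i (z i + h • F z i)

/-- The composition of the shears along the components in a list. -/
def splitStep (F : (∀ i, E i) → ∀ i, E i) (h : ℝ) : List ι → (∀ i, E i) → ∀ i, E i
  | [] => id
  | i :: l => shear F h i ∘ splitStep F h l

variable {F : (∀ i, E i) → ∀ i, E i} {K L : ℝ≥0}

theorem continuous_shear (hF : Continuous F) (h : ℝ) (i : ι) : Continuous (shear F h i) :=
  continuous_id.update i
    ((continuous_apply i).add (((continuous_apply i).comp hF).const_smul h))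

theorem continuous_splitStep (hF : Continuous F) (h : ℝ) (l : List ι) :
    Continuous (splitStep F h l) := by
  induction l with
  | nil => exact continuous_id
  | cons i l ih => exact (continuous_shear hF h i).comp ih

theorem splitStep_apply_of_notMem (h : ℝ) {l : List ι} {i : ι} (hi : i ∉ l) (z : ∀ i, E i) :
    splitStep F h l z i = z i := by
  induction l with
  | nil => rfl
  | cons j l ih =>
    rw [List.mem_cons, not_or] at hi
    simp [splitStep, shear, Function.update_of_ne hi.1, ih hi.2]

theorem splitStep_apply_of_nodup_cons (h : ℝ) {l : List ι} {i : ι} (hl : (i :: l).Nodup)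
    (z : ∀ i, E i) :
    splitStep F h (i :: l) z i = z i + h • F (splitStep F h l z) i := by
  simp [splitStep, shear, splitStep_apply_of_notMem h (List.nodup_cons.1 hl).1]

variable [Fintype ι]

/-- Each coordinate moves at most once, by at most `K * h`; in the sup norm these moves do not add
up. -/
theorem norm_splitStep_sub_le (hK : ∀ x, ‖F x‖ ≤ K) {h : ℝ} (hh : 0 ≤ h) {l : List ι}
    (hl : l.Nodup) (z : ∀ i, E i) : ‖splitStep F h l z - z‖ ≤ K * h := by
  induction l with
  | nil => simpa [splitStep] using by positivity
  | cons i l ih =>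
    refine (pi_norm_le_iff_of_nonneg (by positivity)).2 fun j => ?_
    by_cases hj : j = i
    · subst hj
      rw [Pi.sub_apply, splitStep_apply_of_nodup_cons h hl, add_sub_cancel_left, norm_smul,
        Real.norm_of_nonneg hh, mul_comm]
      gcongr
      exact (norm_le_pi_norm _ j).trans (hK _)
    · have : splitStep F h (i :: l) z j = splitStep F h l z j := by
        simp [splitStep, shear, Function.update_of_ne hj]
      rw [Pi.sub_apply, this]
      exact (norm_le_pi_norm (splitStep F h l z - z) j).trans (ih (List.nodup_cons.1 hl).2)

/-- Coordinate `j` moves by `h` times `F` evaluated within distance `K * h` of `z`, and the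
Lipschitz bound does the rest. -/
theorem norm_splitStep_apply_sub_euler_le (hK : ∀ x, ‖F x‖ ≤ K) (hL : LipschitzWith L F) {h : ℝ}
    (hh : 0 ≤ h) {l : List ι} (hl : l.Nodup) (z : ∀ i, E i) {j : ι} (hj : j ∈ l) :
    ‖splitStep F h l z j - (z j + h • F z j)‖ ≤ L * K * h ^ 2 := by
  induction l with
  | nil => simp at hj
  | cons i l ih =>
    by_cases hji : j = i
    · subst hji
      rw [splitStep_apply_of_nodup_cons h hl, add_sub_add_left_eq_sub, ← smul_sub, norm_smul,
        Real.norm_of_nonneg hh]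
      have h1 : ‖F (splitStep F h l z) j - F z j‖ ≤ L * (K * h) :=
        (norm_le_pi_norm (F (splitStep F h l z) - F z) j).trans <| (hL.norm_sub_le _ _).trans <| by
          gcongr; exact norm_splitStep_sub_le hK hh (List.nodup_cons.1 hl).2 z
      calc _ ≤ h * (L * (K * h)) := by gcongr
        _ = _ := by ring
    · have : splitStep F h (i :: l) z j = splitStep F h l z j := by
        simp [splitStep, shear, Function.update_of_ne hji]
      rw [this]
      exact ih (List.nodup_cons.1 hl).2 ((List.mem_cons.1 hj).resolve_left hji)

theorem norm_splitStep_univ_sub_euler_le (hK : ∀ x, ‖F x‖ ≤ K) (hL : LipschitzWith L F) {h : ℝ}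
    (hh : 0 ≤ h) (z : ∀ i, E i) :
    ‖splitStep F h Finset.univ.toList z - (z + h • F z)‖ ≤ L * K * h ^ 2 :=
  (pi_norm_le_iff_of_nonneg (by positivity)).2 fun j =>
    norm_splitStep_apply_sub_euler_le hK hL hh (Finset.nodup_toList _) z (by simp)

theorem norm_iterate_splitStep_sub_le (hK : ∀ x, ‖F x‖ ≤ K) {h : ℝ} (hh : 0 ≤ h) {l : List ι}
    (hl : l.Nodup) (z : ∀ i, E i) (n : ℕ) :
    ‖(splitStep F h l)^[n] z - z‖ ≤ n * (K * h) := by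
  induction n with
  | zero => simp
  | succ n ih =>
    rw [Function.iterate_succ_apply']
    refine (norm_sub_le_norm_sub_add_norm_sub _ ((splitStep F h l)^[n] z) _).trans ?_
    push_cast
    linarith [norm_splitStep_sub_le hK hh hl ((splitStep F h l)^[n] z)]

variable [∀ i, MeasureSpace (E i)] [∀ i, BorelSpace (E i)] [∀ i, FiniteDimensional ℝ (E i)]
  [∀ i, (volume : Measure (E i)).IsAddHaarMeasure]

/-- A shear along a component that does not depend on its own variable preserves the volume. -/
theorem measurePreserving_shear (hF : Continuous F)
    (hdiv : ∀ z i w, F (Function.update z i w) i = F z i) (h : ℝ) (i : ι) :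
    MeasurePreserving (shear F h i) := by
  have (i : ι) : ProperSpace (E i) := FiniteDimensional.proper ℝ (E i)
  have hm := (continuous_shear hF h i).measurable
  refine ⟨hm, Measure.ext_of_lintegral _ fun f hf => ?_⟩
  -- Fubini puts the integral over coordinate `i` innermost. There the shear is a translation by a
  -- vector that does not involve the integration variable.
  rw [lintegral_map hf hm, volume_pi, lintegral_eq_lmarginal_univ 0, lintegral_eq_lmarginal_univ 0,
    lmarginal_erase' (fun z => f (shear F h i z)) (hf.comp hm) (Finset.mem_univ i), lmarginal_erase' _ hf (Finset.mem_univ i)]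
  congr 2
  funext z
  have : ∀ w, shear F h i (Function.update z i w) = Function.update z i (w + h • F z i) := by
    intro w; simp [shear, hdiv]
  simp_rw [this]
  exact lintegral_add_right_eq_self (fun w => f (Function.update z i w)) (h • F z i)

theorem measurePreserving_splitStep (hF : Continuous F)
    (hdiv : ∀ z i w, F (Function.update z i w) i = F z i) (h : ℝ) (l : List ι) :
    MeasurePreserving (splitStep F h l) := by
  induction l with
  | nil => exact MeasurePreserving.id _
  | cons i l ih => exact (measurePreserving_shear hF hdiv h i).comp ih

/-- The flow of a bounded Lipschitz field whose components do not depend on their own variables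
preserves the volume. -/
theorem IsGlobalFlow.measurePreserving_of_nonneg {φ : ℝ → (∀ i, E i) → ∀ i, E i}
    (hφ : IsGlobalFlow F φ) (hK : ∀ x, ‖F x‖ ≤ K) (hL : LipschitzWith L F)
    (hdiv : ∀ z i w, F (Function.update z i w) i = F z i) {t : ℝ} (ht : 0 ≤ t) :
    MeasurePreserving (φ t) := by
  have (i : ι) : ProperSpace (E i) := FiniteDimensional.proper ℝ (E i)
  set S : ℕ → (∀ i, E i) → ∀ i, E i :=
    fun n => (splitStep F (t / n) Finset.univ.toList)^[n] with hS
  have hSm (n : ℕ) : MeasurePreserving (S n) :=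
    (measurePreserving_splitStep hL.continuous hdiv _ _).iterate n
  have hSc (n : ℕ) : Continuous (S n) := (continuous_splitStep hL.continuous _ _).iterate n
  have hlim (z : ∀ i, E i) : Tendsto (fun n => S n z) atTop (𝓝 (φ t z)) :=
    hφ.tendsto_iterate hK hL (S := fun h => splitStep F h Finset.univ.toList)
      (fun h hh => norm_splitStep_univ_sub_euler_le hK hL hh) ht z
  -- This displacement bound is uniform in `n`, so every `f ∘ S n` vanishes outside one compact
  -- thickening of the support of `f`; this supplies the dominating function below.
  have hfar (n : ℕ) (z : ∀ i, E i) : dist z (S n z) ≤ K * t := by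
    rw [dist_comm, dist_eq_norm]
    refine (norm_iterate_splitStep_sub_le hK (by positivity) (Finset.nodup_toList _) z n).trans ?_
    rcases Nat.eq_zero_or_pos n with rfl | hn
    · simpa using by positivity
    · exact le_of_eq (by field_simp)
  refine ⟨(hφ.continuous hL t).measurable, ?_⟩
  -- Regular measures are determined by the integrals of compactly supported continuous functions,
  -- and only such integrals pass to the limit easily.
  have : (Measure.map (φ t) volume).Regular := Measure.Regular.map (hφ.homeomorph hL t)
  refine Measure.ext_of_integral_eq_on_compactlySupported fun f => ?_
  have hf : Continuous fun z => f z := f.continuous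
  rw [integral_map (hφ.continuous hL t).measurable.aemeasurable
    hf.aestronglyMeasurable]
  have hconst (n : ℕ) : ∫ z, f (S n z) = ∫ z, f z := by
    rw [← integral_map (hSc n).measurable.aemeasurable hf.aestronglyMeasurable,
      (hSm n).map_eq]
  obtain ⟨C, hC⟩ := f.hasCompactSupport.exists_bound_of_continuous f.continuous
  set B := Metric.cthickening (K * t) (tsupport f)
  have hB : IsCompact B := f.hasCompactSupport.isCompact.cthickening
  have hconv : Tendsto (fun n => ∫ z, f (S n z)) atTop (𝓝 (∫ z, f (φ t z))) := by
    refine tendsto_integral_of_dominated_convergence (B.indicator fun _ => C)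
      (fun n => (f.continuous.comp (hSc n)).aestronglyMeasurable)
      ((integrable_indicator_iff hB.measurableSet).2
        (integrableOn_const hB.measure_lt_top.ne)) (fun n => ae_of_all _ fun z => ?_)
      (ae_of_all _ fun z => (f.continuous.tendsto _).comp (hlim z))
    by_cases hz : z ∈ B
    · rw [indicator_of_mem hz]; exact hC _
    · have h0 : f (S n z) = 0 := image_eq_zero_of_notMem_tsupport fun hmem =>
        hz (Metric.mem_cthickening_of_dist_le _ _ _ _ hmem (hfar n z))
      rw [indicator_of_notMem hz, h0, norm_zero]
  simp_rw [hconst] at hconv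
  exact tendsto_nhds_unique hconv tendsto_const_nhds

theorem IsGlobalFlow.measurePreserving {φ : ℝ → (∀ i, E i) → ∀ i, E i}
    (hφ : IsGlobalFlow F φ) (hK : ∀ x, ‖F x‖ ≤ K) (hL : LipschitzWith L F)
    (hdiv : ∀ z i w, F (Function.update z i w) i = F z i) (t : ℝ) :
    MeasurePreserving (φ t) := by
  rcases le_total 0 t with ht | ht
  · exact hφ.measurePreserving_of_nonneg hK hL hdiv ht
  · simpa using hφ.neg.measurePreserving_of_nonneg (K := K) (L := L) (by simpa using hK) hL.neg
      (by simpa using hdiv) (neg_nonneg.2 ht)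

end Shear

/-! ### Log-ratio coordinates -/

namespace FiniteGame

noncomputable section

section Softmax

open scoped NNReal

/-- The logarithms of the ratios of the coordinates to the `0`-th coordinate. -/
def logRatioPlayer {n : ℕ} (x : Fin (n + 1) → ℝ) : Fin n → ℝ :=
  fun a => Real.log (x a.succ) - Real.log (x 0)

/-- The logit choice map, which inverts `logRatioPlayer` on the open simplex. -/
def softmaxPlayer {n : ℕ} (z : Fin n → ℝ) : Fin (n + 1) → ℝ :=
  fun a => Real.exp ((Fin.cons 0 z : Fin (n + 1) → ℝ) a) /
    ∑ b, Real.exp ((Fin.cons 0 z : Fin (n + 1) → ℝ) b)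

variable {n : ℕ}

theorem sum_exp_pos (w : Fin (n + 1) → ℝ) : 0 < ∑ b, Real.exp (w b) :=
  Finset.sum_pos (fun _ _ => Real.exp_pos _) Finset.univ_nonempty

theorem softmaxPlayer_pos (z : Fin n → ℝ) (a : Fin (n + 1)) : 0 < softmaxPlayer z a :=
  div_pos (Real.exp_pos _) (sum_exp_pos _)

theorem sum_softmaxPlayer (z : Fin n → ℝ) : ∑ a, softmaxPlayer z a = 1 := by
  simp_rw [softmaxPlayer, ← Finset.sum_div]
  exact div_self (sum_exp_pos _).ne'

theorem softmaxPlayer_le_one (z : Fin n → ℝ) (a : Fin (n + 1)) : softmaxPlayer z a ≤ 1 := by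
  rw [← sum_softmaxPlayer z]
  exact Finset.single_le_sum (fun b _ => (softmaxPlayer_pos z b).le) (Finset.mem_univ a)

theorem logRatioPlayer_softmaxPlayer (z : Fin n → ℝ) : logRatioPlayer (softmaxPlayer z) = z := by
  funext a
  simp [logRatioPlayer, softmaxPlayer, Real.log_div, (sum_exp_pos _).ne', Real.exp_ne_zero]

theorem softmaxPlayer_logRatioPlayer {x : Fin (n + 1) → ℝ} (hx : ∀ a, 0 < x a)
    (hx1 : ∑ a, x a = 1) : softmaxPlayer (logRatioPlayer x) = x := by
  have h : ∀ a, Real.exp ((Fin.cons 0 (logRatioPlayer x) : Fin (n + 1) → ℝ) a) = x a / x 0 := by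
    refine Fin.cases ?_ fun a => ?_
    · simp [(hx 0).ne']
    · simp [logRatioPlayer, Real.exp_sub, Real.exp_log, hx]
  funext a
  simp_rw [softmaxPlayer, h, ← Finset.sum_div, hx1]
  have := (hx 0).ne'
  field_simp

/-- A perturbation of size `δ` changes numerator and denominator each by a factor within `exp (±δ)`,
so a probability shrinks at most by `exp (-2δ) ≥ 1 - 2δ`; probabilities are at most `1`. -/
theorem sub_softmaxPlayer_le (z z' : Fin n → ℝ) (a : Fin (n + 1)) :
    softmaxPlayer z a - softmaxPlayer z' a ≤ 2 * ‖z - z'‖ := by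
  set δ := ‖z - z'‖
  set w : Fin (n + 1) → ℝ := Fin.cons 0 z
  set w' : Fin (n + 1) → ℝ := Fin.cons 0 z'
  have hδ : 0 ≤ δ := norm_nonneg _
  have hw : ∀ b, |w b - w' b| ≤ δ := by
    refine Fin.cases ?_ fun b => ?_
    · simpa [w, w'] using hδ
    · simpa [w, w'] using norm_le_pi_norm (z - z') b
  have h1 : Real.exp (-δ) * Real.exp (w a) ≤ Real.exp (w' a) := by
    rw [← Real.exp_add]
    exact Real.exp_le_exp.2 (by linarith [(abs_le.1 (hw a)).2])
  have h2 : ∑ b, Real.exp (w' b) ≤ Real.exp δ * ∑ b, Real.exp (w b) := by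
    rw [Finset.mul_sum]
    refine Finset.sum_le_sum fun b _ => ?_
    rw [← Real.exp_add]
    exact Real.exp_le_exp.2 (by linarith [(abs_le.1 (hw b)).1])
  have h3 : Real.exp (-(2 * δ)) * softmaxPlayer z a ≤ softmaxPlayer z' a := by
    calc _ = Real.exp (-δ) * Real.exp (w a) / (Real.exp δ * ∑ b, Real.exp (w b)) := by
          have : Real.exp (-(2 * δ)) = Real.exp (-δ) / Real.exp δ := by
            rw [← Real.exp_sub]; ring_nf
          rw [this, softmaxPlayer, div_mul_div_comm]
      _ ≤ Real.exp (w' a) / ∑ b, Real.exp (w' b) :=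
          div_le_div₀ (Real.exp_pos _).le h1 (sum_exp_pos _) h2
  nlinarith [Real.add_one_le_exp (-(2 * δ)), softmaxPlayer_le_one z a, softmaxPlayer_pos z a]

theorem lipschitzWith_softmaxPlayer : LipschitzWith 2 (softmaxPlayer (n := n)) := by
  refine LipschitzWith.of_dist_le_mul fun z z' => ?_
  rw [dist_eq_norm, dist_eq_norm]
  refine (pi_norm_le_iff_of_nonneg (by positivity)).2 fun a => abs_le.2 ⟨?_, ?_⟩
  · have := sub_softmaxPlayer_le z' z a
    rw [norm_sub_rev] at this
    simpa using by linarith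
  · simpa using sub_softmaxPlayer_le z z' a

variable {ι : Type*} {m : ι → ℕ}

/-- The log-ratio coordinates of a strategy profile, player by player. -/
def logRatio (x : Profile m) : EffProfile m := fun i => logRatioPlayer (x i)

/-- The logit choice map, player by player. -/
def softmax (z : EffProfile m) : Profile m := fun i => softmaxPlayer (z i)

/-- The log-ratio coordinates identify the interior strategy profiles with a Euclidean space. -/
def logRatioHomeomorph (m : ι → ℕ) : IntStrategies m ≃ₜ EffProfile m where
  toFun x := logRatio x.1
  invFun z := ⟨softmax z, fun _ => ⟨softmaxPlayer_pos _, sum_softmaxPlayer _⟩⟩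
  left_inv x := Subtype.ext <| funext fun i =>
    softmaxPlayer_logRatioPlayer (x.2 i).1 (x.2 i).2
  right_inv z := funext fun _ => logRatioPlayer_softmaxPlayer _
  continuous_toFun := by
    have h (i : ι) (a : Fin (m i + 1)) : Continuous fun x : IntStrategies m => Real.log (x.1 i a) :=
      Continuous.log ((continuous_apply a).comp ((continuous_apply i).comp continuous_subtype_val)) fun x => ((x.2 i).1 a).ne'
    exact continuous_pi fun i => continuous_pi fun a => (h i a.succ).sub (h i 0)
  continuous_invFun := Continuous.subtype_mk (continuous_pi fun i =>
    lipschitzWith_softmaxPlayer.continuous.comp (continuous_apply i)) _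

theorem softmax_mem_Icc (z : EffProfile m) : softmax z ∈ Set.Icc (0 : Profile m) 1 :=
  ⟨fun _ _ => (softmaxPlayer_pos _ _).le, fun _ _ => softmaxPlayer_le_one _ _⟩

theorem lipschitzWith_softmax [Fintype ι] : LipschitzWith 2 (softmax (m := m)) := by
  refine LipschitzWith.of_dist_le_mul fun z z' => ?_
  refine (dist_pi_le_iff (by positivity)).2 fun i => ?_
  refine (lipschitzWith_softmaxPlayer.dist_le_mul _ _).trans ?_
  gcongr
  exact dist_le_pi_dist z z' i

end Softmax

/-! ### The replicator field in log-ratio coordinates -/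

section LogField

open Set Filter Topology
open scoped NNReal

variable {ι : Type*} [Fintype ι] [DecidableEq ι] {m : ι → ℕ} (G : FiniteGame m)

theorem contDiff_mixedPayoff (i : ι) : ContDiff ℝ 1 (G.mixedPayoff i) := by
  refine ContDiff.sum fun α _ => contDiff_const.mul (contDiff_prod fun j _ => ?_)
  exact (contDiff_apply ℝ ℝ (α j)).comp (ContinuousLinearMap.proj (R := ℝ) (φ := fun j => Fin (m j + 1) → ℝ) j).contDiff

theorem contDiff_payoffField (i : ι) (a : Fin (m i + 1)) :
    ContDiff ℝ 1 fun x => G.payoffField x i a := by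
  refine (G.contDiff_mixedPayoff i).comp (contDiff_pi.2 fun j => ?_)
  by_cases hj : j = i
  · subst hj; simpa using contDiff_const
  · simp only [Function.update_of_ne hj]
    exact (ContinuousLinearMap.proj (R := ℝ) (φ := fun j => Fin (m j + 1) → ℝ) j).contDiff

theorem payoffField_update (x : Profile m) (i : ι) (w : Fin (m i + 1) → ℝ) (a : Fin (m i + 1)) :
    G.payoffField (Function.update x i w) i a = G.payoffField x i a := by
  simp [payoffField]

theorem payoffField_eq_sum (x : Profile m) (i : ι) (a : Fin (m i + 1)) :
    G.payoffField x i a = ∑ α : (∀ j, Fin (m j + 1)),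
      if α i = a then G.payoff i α * ∏ j ∈ Finset.univ.erase i, x j (α j) else 0 := by
  unfold payoffField mixedPayoff
  refine Finset.sum_congr rfl fun α _ => ?_
  rw [← Finset.mul_prod_erase _ _ (Finset.mem_univ i), Function.update_self, Pi.single_apply,
    Finset.prod_congr rfl fun j hj => by rw [Function.update_of_ne (Finset.ne_of_mem_erase hj)]]
  split_ifs <;> simp

/-- The mixed payoff is the average of the payoffs of the pure actions. -/
theorem sum_mul_payoffField (x : Profile m) (i : ι) :
    ∑ a, x i a * G.payoffField x i a = G.mixedPayoff i x := by
  simp_rw [payoffField_eq_sum, Finset.mul_sum]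
  rw [Finset.sum_comm]
  refine Finset.sum_congr rfl fun α _ => ?_
  rw [← Finset.mul_prod_erase _ _ (Finset.mem_univ i)]
  simp
  ring

/-- The replicator field in log-ratio coordinates. -/
def logField (z : EffProfile m) : EffProfile m :=
  fun i a => G.payoffField (softmax z) i a.succ - G.payoffField (softmax z) i 0

/-- This is the form of vanishing divergence that the shear argument needs: moving `z_i` changes
only the strategy of player `i`, which that player's payoff field ignores. -/
theorem logField_update (z : EffProfile m) (i : ι) (w : Fin (m i) → ℝ) :
    G.logField (Function.update z i w) i = G.logField z i := by
  have : softmax (Function.update z i w) = Function.update (softmax z) i (softmaxPlayer w) := by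
    funext j
    by_cases hj : j = i
    · subst hj; simp [softmax]
    · simp [softmax, Function.update_of_ne hj]
  funext a
  simp [logField, this, payoffField_update]

/-- The field is a polynomial map composed with `softmax`, which is Lipschitz and takes values in a
compact cube. -/
theorem logField_bounded_lipschitz :
    ∃ K L : ℝ≥0, (∀ z, ‖G.logField z‖ ≤ K) ∧ LipschitzWith L G.logField := by
  set P : Profile m → EffProfile m :=
    fun x i a => G.payoffField x i a.succ - G.payoffField x i 0
  have hP : ContDiff ℝ 1 P := contDiff_pi.2 fun i => contDiff_pi.2 fun a =>
    (G.contDiff_payoffField i a.succ).sub (G.contDiff_payoffField i 0)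
  have hc : IsCompact (Icc (0 : Profile m) 1) := isCompact_Icc
  obtain ⟨C, hC⟩ := hc.exists_bound_of_continuousOn hP.continuous.continuousOn
  obtain ⟨L, hL⟩ := (hP.locallyLipschitz.locallyLipschitzOn).exists_lipschitzOnWith_of_compact hc
  refine ⟨⟨max C 0, le_max_right _ _⟩, L * 2,
    fun z => (hC _ (softmax_mem_Icc z)).trans (le_max_left _ _), ?_⟩
  rw [← lipschitzOnWith_univ]
  exact hL.comp (lipschitzWith_softmax.lipschitzOnWith) fun z _ => softmax_mem_Icc z

theorem hasDerivAt_log_of_replicator {x : ℝ → IntStrategies m} {t : ℝ}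
    (hx : HasDerivAt (fun s => (x s).1) (G.replicatorField (x t).1) t) (i : ι)
    (a : Fin (m i + 1)) :
    HasDerivAt (fun s => Real.log ((x s).1 i a))
      (G.payoffField (x t).1 i a - G.mixedPayoff i (x t).1) t := by
  have h := hasDerivAt_pi.1 (hasDerivAt_pi.1 hx i) a
  have h0 := (((x t).2 i).1 a).ne'
  convert h.log h0 using 1
  rw [replicatorField, mul_div_cancel_left₀ _ h0]

theorem hasDerivAt_logRatio {x : ℝ → IntStrategies m} {t : ℝ}
    (hx : HasDerivAt (fun s => (x s).1) (G.replicatorField (x t).1) t) :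
    HasDerivAt (fun s => logRatioHomeomorph m (x s)) (G.logField (logRatioHomeomorph m (x t))) t := by
  have hs : softmax (logRatioHomeomorph m (x t)) = (x t).1 :=
    congrArg Subtype.val ((logRatioHomeomorph m).symm_apply_apply (x t))
  refine hasDerivAt_pi.2 fun i => hasDerivAt_pi.2 fun a => ?_
  refine ((G.hasDerivAt_log_of_replicator hx i a.succ).sub
    (G.hasDerivAt_log_of_replicator hx i 0)).congr_deriv ?_
  simp only [logField, hs]
  ring

theorem hasDerivAt_softmaxPlayer {n : ℕ} {z : ℝ → Fin n → ℝ} {z' : Fin n → ℝ} {t : ℝ}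
    (hz : HasDerivAt z z' t) (a : Fin (n + 1)) :
    HasDerivAt (fun s => softmaxPlayer (z s) a) (softmaxPlayer (z t) a *
      ((Fin.cons 0 z' : Fin (n + 1) → ℝ) a -
        ∑ b, softmaxPlayer (z t) b * (Fin.cons 0 z' : Fin (n + 1) → ℝ) b)) t := by
  have hw : ∀ b, HasDerivAt (fun s => (Fin.cons 0 (z s) : Fin (n + 1) → ℝ) b)
      ((Fin.cons 0 z' : Fin (n + 1) → ℝ) b) t := by
    refine Fin.cases ?_ fun b => ?_
    · simpa using hasDerivAt_const t (0 : ℝ)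
    · simpa using hasDerivAt_pi.1 hz b
  have hS := (sum_exp_pos (Fin.cons 0 (z t) : Fin (n + 1) → ℝ)).ne'
  have := (hw a).exp.div (HasDerivAt.fun_sum fun b (_ : b ∈ Finset.univ) => (hw b).exp) hS
  refine this.congr_deriv ?_
  simp only [softmaxPlayer]
  simp_rw [div_mul_eq_mul_div, ← Finset.sum_div]
  field_simp

theorem hasDerivAt_softmax {z : ℝ → EffProfile m} {t : ℝ}
    (hz : HasDerivAt z (G.logField (z t)) t) :
    HasDerivAt (fun s => softmax (z s)) (G.replicatorField (softmax (z t))) t := by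
  refine hasDerivAt_pi.2 fun i => hasDerivAt_pi.2 fun a => ?_
  refine (hasDerivAt_softmaxPlayer (hasDerivAt_pi.1 hz i) a).congr_deriv ?_
  -- The prepended `0` fits the same formula at `b = 0`. The common term `v_{i0}` then drops out on
  -- subtracting the mean, leaving `v_{ia} - u_i`.
  have h : ∀ b, (Fin.cons 0 (G.logField (z t) i) : Fin (m i + 1) → ℝ) b =
      G.payoffField (softmax (z t)) i b - G.payoffField (softmax (z t)) i 0 := by
    refine Fin.cases ?_ fun b => ?_
    · simp
    · simp [logField]
  simp_rw [h, mul_sub, Finset.sum_sub_distrib, ← Finset.sum_mul, sum_softmaxPlayer]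
  have := G.sum_mul_payoffField (softmax (z t)) i
  simp only [softmax] at this ⊢
  rw [this]
  simp only [replicatorField, softmax]
  ring

/-- In log-ratio coordinates, the flow of the replicator dynamics is that of `logField`. -/
theorem IsReplicatorFlow.isGlobalFlow {Φ : ℝ → IntStrategies m → IntStrategies m}
    (h : G.IsReplicatorFlow Φ) :
    IsGlobalFlow G.logField
      fun t z => logRatioHomeomorph m (Φ t ((logRatioHomeomorph m).symm z)) where
  start z := by simp [h.start]
  solves z t := G.hasDerivAt_logRatio (x := fun s => Φ s ((logRatioHomeomorph m).symm z))
    (h.solves _ t)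

theorem existsUnique_isReplicatorFlow :
    ∃! Φ : ℝ → IntStrategies m → IntStrategies m, G.IsReplicatorFlow Φ := by
  obtain ⟨K, L, hK, hL⟩ := G.logField_bounded_lipschitz
  obtain ⟨φ, hφ⟩ := exists_isGlobalFlow_of_bounded_lipschitz hK hL
  set e := logRatioHomeomorph m
  refine ⟨fun t x => e.symm (φ t (e x)), ⟨fun x => by simp [hφ.start], fun x t =>
    G.hasDerivAt_softmax (hφ.solves (e x) t)⟩, fun Ψ hΨ => ?_⟩
  funext t x
  have := congrFun (integralCurve_eq_of_lipschitz hL (hΨ.isGlobalFlow.solves (e x))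
    (hφ.solves (e x)) (by rw [hΨ.isGlobalFlow.start, hφ.start])) t
  rw [← this]
  simp [e]

end LogField

end

end FiniteGame

/-! ### The Shahshahani metric in log-ratio coordinates -/

theorem Matrix.det_blockDiagonal' {ι : Type*} [Fintype ι] [DecidableEq ι] {n : ι → Type*}
    [∀ i, Fintype (n i)] [∀ i, DecidableEq (n i)] {R : Type*} [CommRing R]
    (M : ∀ i, Matrix (n i) (n i) R) :
    (Matrix.blockDiagonal' M).det = ∏ i, (M i).det := by
  classical
  -- An arbitrary order, chosen only to view the matrix as block triangular.
  let _ : LinearOrder ι := linearOrderOfSTO WellOrderingRel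
  rw [(Matrix.blockTriangular_blockDiagonal' M).det_fintype]
  refine Finset.prod_congr rfl fun i _ => ?_
  rw [← Matrix.det_submatrix_equiv_self (Equiv.sigmaSubtype i).symm]
  congr 1
  ext a b
  simp [Matrix.toSquareBlock, Matrix.toSquareBlockProp, Equiv.sigmaSubtype,
    Matrix.blockDiagonal'_apply_eq]

namespace FiniteGame

noncomputable section

open Set Filter Topology MeasureTheory

theorem playerMetric_apply {n : ℕ} (y : Fin n → ℝ) (a b : Fin n) :
    playerMetric y a b = (if a = b then (y a)⁻¹ else 0) + (1 - ∑ c, y c)⁻¹ := by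
  simp only [playerMetric, Matrix.of_apply, shahshahaniInner, effBasisVec, ofEffPlayer,
    Fin.sum_univ_succ, Pi.sub_apply, Fin.cons_zero, Fin.cons_succ]
  have h (c : Fin n) : ((Pi.single a.succ 1 : Fin (n + 1) → ℝ) c.succ -
      (Pi.single 0 1 : Fin (n + 1) → ℝ) c.succ) * ((Pi.single b.succ 1 : Fin (n + 1) → ℝ) c.succ -
      (Pi.single 0 1 : Fin (n + 1) → ℝ) c.succ) / y c =
      if c = a then (if a = b then (y a)⁻¹ else 0) else 0 := by
    by_cases hc : c = a
    · subst hc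
      by_cases hb : c = b <;> simp [hb]
    · simp [Pi.single_apply, hc]
  simp_rw [h]
  simp [(Fin.succ_ne_zero _).symm, add_comm]

theorem prod_ofEffPlayer {n : ℕ} (y : Fin n → ℝ) :
    ∏ a, ofEffPlayer y a = (1 - ∑ a, y a) * ∏ a, y a := by
  simp [ofEffPlayer, Fin.prod_univ_succ]

theorem det_playerMetric {n : ℕ} {y : Fin n → ℝ} (hy : ∀ a, 0 < y a) (hy1 : ∑ a, y a < 1) :
    (playerMetric y).det = (∏ a, ofEffPlayer y a)⁻¹ := by
  have h0 : (1 - ∑ a, y a) ≠ 0 := by linarith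
  have hne : ∀ a, y a ≠ 0 := fun a => (hy a).ne'
  have hP : ∏ a, y a ≠ 0 := Finset.prod_ne_zero_iff.2 fun a _ => hne a
  -- The metric is a diagonal matrix times a rank-one perturbation of the identity, whose
  -- determinant is `1 + (∑ y) / x₀ = 1 / x₀`.
  have hM : playerMetric y = Matrix.diagonal (fun a => (y a)⁻¹) *
      (1 + Matrix.replicateCol Unit y * Matrix.replicateRow Unit fun _ => (1 - ∑ c, y c)⁻¹) := by
    ext a b
    rw [playerMetric_apply, Matrix.diagonal_mul]
    have := hne a
    by_cases hab : a = b
    · subst hab; simp [Matrix.mul_apply, mul_add]; field_simp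
    · simp [Matrix.mul_apply, hab]; field_simp
  rw [hM, Matrix.det_mul, Matrix.det_diagonal, Matrix.det_one_add_replicateCol_mul_replicateRow,
    prod_ofEffPlayer, Finset.prod_inv_distrib]
  simp only [dotProduct, ← Finset.mul_sum]
  field_simp
  ring

variable {ι : Type*} {m : ι → ℕ}

theorem ofEff_toEff (x : IntStrategies m) : ofEff (toEff x.1) = x.1 := by
  funext i
  refine funext (Fin.cases ?_ fun a => ?_)
  · have := (x.2 i).2
    rw [Fin.sum_univ_succ] at this
    simp only [ofEff, ofEffPlayer, toEff, Fin.cons_zero]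
    linarith
  · simp [ofEff, ofEffPlayer, toEff]

theorem toEff_mem_openCorner (x : IntStrategies m) : toEff x.1 ∈ openCorner m := by
  intro i
  have := (x.2 i).2
  rw [Fin.sum_univ_succ] at this
  exact ⟨fun a => (x.2 i).1 _, by simp only [toEff]; linarith [(x.2 i).1 0]⟩

theorem ofEff_pos {y : EffProfile m} (hy : y ∈ openCorner m) (i : ι) (a : Fin (m i + 1)) :
    0 < ofEff y i a := by
  refine Fin.cases ?_ (fun a => ?_) a
  · simpa [ofEff, ofEffPlayer] using (hy i).2
  · simpa [ofEff, ofEffPlayer] using (hy i).1 a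

theorem sum_ofEff (y : EffProfile m) (i : ι) : ∑ a, ofEff y i a = 1 := by
  simp [ofEff, ofEffPlayer, Fin.sum_univ_succ]

theorem toEff_ofEff (y : EffProfile m) : toEff (ofEff y) = y := by
  funext i a; simp [toEff, ofEff, ofEffPlayer]

theorem continuous_ofEff : Continuous (ofEff (m := m)) :=
  continuous_pi fun i => continuous_pi <| Fin.cases
    (by simpa [ofEff, ofEffPlayer] using by fun_prop)
    (fun a => by simpa [ofEff, ofEffPlayer] using by fun_prop)

theorem logRatio_injOn : InjOn (fun y => logRatio (ofEff y)) (openCorner m) := by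
  intro y hy y' hy' h
  rw [← toEff_ofEff y, ← toEff_ofEff y']
  congr 1
  funext i
  rw [← softmaxPlayer_logRatioPlayer (ofEff_pos hy i) (sum_ofEff y i),
    ← softmaxPlayer_logRatioPlayer (ofEff_pos hy' i) (sum_ofEff y' i)]
  exact congrArg softmaxPlayer (congrFun h i)

variable [Fintype ι]

theorem isOpen_openCorner : IsOpen (openCorner m) := by
  simp only [openCorner, ofPred_forall, ofPred_and]
  refine isOpen_iInter_of_finite fun i => .inter (isOpen_iInter_of_finite fun a => ?_) ?_
  · exact isOpen_lt continuous_const (by fun_prop)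
  · exact isOpen_lt (by fun_prop) continuous_const

theorem isOpen_image_toEff {B : Set (IntStrategies m)} (hB : IsOpen B) :
    IsOpen ((fun x : IntStrategies m => toEff x.1) '' B) := by
  obtain ⟨U, hU, rfl⟩ := isOpen_induced_iff.1 hB
  convert isOpen_openCorner.inter (hU.preimage (continuous_ofEff (m := m))) using 1
  ext y
  constructor
  · rintro ⟨x, hx, rfl⟩
    exact ⟨toEff_mem_openCorner x, by simpa only [mem_preimage, ofEff_toEff] using hx⟩
  · rintro ⟨hy, hyU⟩
    exact ⟨⟨ofEff y, fun i => ⟨ofEff_pos hy i, sum_ofEff y i⟩⟩, hyU, toEff_ofEff y⟩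

variable [DecidableEq ι]

theorem det_effMetric {y : EffProfile m} (hy : y ∈ openCorner m) :
    (effMetric y).det = (∏ i, ∏ a, ofEff y i a)⁻¹ := by
  rw [effMetric, Matrix.det_blockDiagonal', ← Finset.prod_inv_distrib]
  exact Finset.prod_congr rfl fun i _ => det_playerMetric (hy i).1 (hy i).2

/-- The linear endomorphism of `EffProfile m` with matrix `effMetric y`. -/
def metricMap (y : EffProfile m) : EffProfile m →L[ℝ] EffProfile m :=
  ContinuousLinearMap.pi fun i =>
    (Matrix.mulVecLin (playerMetric (y i))).toContinuousLinearMap.comp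
      (ContinuousLinearMap.proj i)

omit [Fintype ι] [DecidableEq ι] in
theorem metricMap_apply (y v : EffProfile m) (i : ι) :
    metricMap y v i = Matrix.mulVec (playerMetric (y i)) (v i) := rfl

theorem det_metricMap (y : EffProfile m) : (metricMap y).det = (effMetric y).det := by
  rw [ContinuousLinearMap.det,
    ← LinearMap.det_toMatrix (Pi.basis fun i => Pi.basisFun ℝ (Fin (m i)))]
  congr 1
  ext ⟨i, a⟩ ⟨j, b⟩
  rw [LinearMap.toMatrix_apply, Pi.basis_repr, ContinuousLinearMap.coe_coe, metricMap_apply,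
    Pi.basis_apply, effMetric, Pi.basisFun_repr, Pi.basisFun_apply]
  by_cases hij : i = j
  · subst hij
    simp [Matrix.blockDiagonal'_apply_eq]
  · simp [Matrix.blockDiagonal'_apply_ne _ _ _ hij, hij]

omit [DecidableEq ι] in
-- The log-ratios form the gradient of `∑ x log x` in the coordinates `y`, and the Shahshahani
-- metric is its Hessian.
theorem hasFDerivAt_logRatio_ofEff {y : EffProfile m} (hy : y ∈ openCorner m) :
    HasFDerivAt (fun y => logRatio (ofEff y)) (metricMap y) y := by
  refine hasFDerivAt_pi'' fun i => hasFDerivAt_pi'' fun a => ?_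
  let p (b : Fin (m i)) : EffProfile m →L[ℝ] ℝ :=
    (ContinuousLinearMap.proj (R := ℝ) (φ := fun _ : Fin (m i) => ℝ) b).comp
      (ContinuousLinearMap.proj (R := ℝ) (φ := fun j => Fin (m j) → ℝ) i)
  have h0 : (1 - ∑ b, p b y) ≠ 0 := by
    have := (hy i).2
    simp only [p, ContinuousLinearMap.comp_apply, ContinuousLinearMap.proj_apply]
    linarith
  have h1 : p a y ≠ 0 := ((hy i).1 a).ne'
  have hs : HasFDerivAt (fun z : EffProfile m => 1 - ∑ b, p b z) (-∑ b, p b) y :=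
    (HasFDerivAt.fun_sum fun b _ => (p b).hasFDerivAt).const_sub 1
  refine (((p a).hasFDerivAt.log h1).sub (hs.log h0)).congr_fderiv ?_
  ext v
  simp [p, metricMap_apply, Matrix.mulVec, dotProduct, playerMetric_apply, add_mul,
    Finset.sum_add_distrib, Finset.mul_sum]

/-- In log-ratio coordinates, the Shahshahani volume has the density `√(∏ i, ∏ a, x i a)`. -/
theorem shahshahaniVolume_eq_setLIntegral {B : Set (IntStrategies m)} (hB : IsOpen B) :
    shahshahaniVolume B = ∫⁻ z in logRatioHomeomorph m '' B,
      ENNReal.ofReal (Real.sqrt (∏ i, ∏ a, softmax z i a)) := by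
  set D := (fun x : IntStrategies m => toEff x.1) '' B
  have hD : D ⊆ openCorner m := by
    rintro _ ⟨x, _, rfl⟩
    exact toEff_mem_openCorner x
  have himg : logRatioHomeomorph m '' B = (fun y => logRatio (ofEff y)) '' D := by
    rw [image_image]
    exact image_congr fun x _ => by rw [ofEff_toEff]; rfl
  rw [himg, lintegral_image_eq_lintegral_abs_det_fderiv_mul volume
    (isOpen_image_toEff hB).measurableSet
    (fun y hy => (hasFDerivAt_logRatio_ofEff (hD hy)).hasFDerivWithinAt)
    (logRatio_injOn.mono hD)]
  refine setLIntegral_congr_fun (isOpen_image_toEff hB).measurableSet fun y hy => ?_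
  have hpos : 0 < ∏ i, ∏ a, ofEff y i a :=
    Finset.prod_pos fun i _ => Finset.prod_pos fun a _ => ofEff_pos (hD hy) i a
  have hsm : softmax (logRatio (ofEff y)) = ofEff y := funext fun i =>
    softmaxPlayer_logRatioPlayer (ofEff_pos (hD hy) i) (sum_ofEff y i)
  simp only [hsm]
  -- With `P` the product of the coordinates, what remains is `√(1 / P) = (1 / P) * √P`.
  rw [det_metricMap, det_effMetric (hD hy), abs_of_pos (inv_pos.2 hpos),
    ← ENNReal.ofReal_mul (inv_pos.2 hpos).le, Real.sqrt_inv]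
  congr 1
  have := Real.sq_sqrt hpos.le
  have := Real.sqrt_pos.2 hpos
  field_simp
  linarith

end

end FiniteGame

/-! ### Incompressible games -/

namespace FiniteGame

noncomputable section

open Set Filter Topology MeasureTheory

/-- The exponential form reduces differentiating the density to differentiating logarithms. -/
theorem sqrt_det_playerMetric {n : ℕ} {y : Fin n → ℝ} (hy : ∀ a, 0 < y a) (hy1 : ∑ a, y a < 1) :
    Real.sqrt (playerMetric y).det =
      Real.exp (-(1 / 2) * (Real.log (1 - ∑ a, y a) + ∑ a, Real.log (y a))) := by
  have h0 : 0 < 1 - ∑ a, y a := by linarith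
  have hP : 0 < ∏ a, y a := Finset.prod_pos fun a _ => hy a
  rw [det_playerMetric hy hy1, prod_ofEffPlayer, ← Real.log_prod fun a _ => (hy a).ne',
    ← Real.log_mul h0.ne' hP.ne', Real.sqrt_inv, Real.sqrt_eq_rpow,
    Real.rpow_def_of_pos (mul_pos h0 hP), ← Real.exp_neg]
  ring_nf

theorem hasDerivAt_sqrt_det_playerMetric {n : ℕ} {y : Fin n → ℝ} (hy : ∀ a, 0 < y a)
    (hy1 : ∑ a, y a < 1) (a : Fin n) :
    HasDerivAt (fun t : ℝ => Real.sqrt (playerMetric (y + t • Pi.single a 1)).det)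
      (Real.sqrt (playerMetric y).det * (-(1 / 2) * ((y a)⁻¹ - (1 - ∑ b, y b)⁻¹))) 0 := by
  have hc (b : Fin n) : HasDerivAt (fun t : ℝ => (y + t • Pi.single a 1 : Fin n → ℝ) b)
      ((Pi.single a 1 : Fin n → ℝ) b) 0 := by
    simpa using ((hasDerivAt_id (0 : ℝ)).mul_const ((Pi.single a 1 : Fin n → ℝ) b)).const_add (y b)
  have hs : HasDerivAt (fun t : ℝ => 1 - ∑ b, (y + t • Pi.single a 1 : Fin n → ℝ) b)
      (-∑ b, (Pi.single a 1 : Fin n → ℝ) b) 0 :=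
    (HasDerivAt.fun_sum fun b _ => hc b).const_sub 1
  have hb (b : Fin n) : HasDerivAt
      (fun t : ℝ => Real.log ((y + t • Pi.single a 1 : Fin n → ℝ) b))
      ((Pi.single a 1 : Fin n → ℝ) b / y b) 0 := by
    simpa using (hc b).log (by simpa using (hy b).ne')
  have h0 : HasDerivAt
      (fun t : ℝ => Real.log (1 - ∑ b, (y + t • Pi.single a 1 : Fin n → ℝ) b))
      (-(∑ b, (Pi.single a 1 : Fin n → ℝ) b) / (1 - ∑ b, y b)) 0 := by
    convert hs.log (by simpa using by linarith) using 2
    simp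
  have hmain := ((h0.add (HasDerivAt.fun_sum fun b (_ : b ∈ Finset.univ) => hb b)).const_mul
    (-(1 / 2))).exp
  -- The exponential form holds only inside the simplex, hence only for small `t`.
  have hev : (fun t : ℝ => Real.sqrt (playerMetric (y + t • Pi.single a 1)).det) =ᶠ[𝓝 0] fun t =>
      Real.exp (-(1 / 2) * (Real.log (1 - ∑ b, (y + t • Pi.single a 1 : Fin n → ℝ) b) +
        ∑ b, Real.log ((y + t • Pi.single a 1 : Fin n → ℝ) b))) := by
    have h1 : ∀ᶠ t : ℝ in 𝓝 0, ∀ b, 0 < (y + t • Pi.single a 1 : Fin n → ℝ) b :=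
      eventually_all.2 fun b => continuousAt_const.eventually_lt (hc b).continuousAt
        (by simpa using hy b)
    have h2 : ∀ᶠ t : ℝ in 𝓝 0, 0 < 1 - ∑ b, (y + t • Pi.single a 1 : Fin n → ℝ) b :=
      continuousAt_const.eventually_lt hs.continuousAt (by simpa using by linarith)
    filter_upwards [h1, h2] with t ht1 ht2
    exact sqrt_det_playerMetric ht1 (by linarith)
  refine (hmain.congr_of_eventuallyEq hev).congr_deriv ?_
  rw [sqrt_det_playerMetric hy hy1]
  simp [Pi.single_apply, ite_div, neg_div]
  ring

variable {ι : Type*} [Fintype ι] [DecidableEq ι] {m : ι → ℕ} (G : FiniteGame m)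

theorem effPayoffField_update (y : EffProfile m) (i : ι) (w : Fin (m i) → ℝ) :
    G.effPayoffField (Function.update y i w) i = G.effPayoffField y i := by
  have : ofEff (Function.update y i w) = Function.update (ofEff y) i (ofEffPlayer w) := by
    funext j
    by_cases hj : j = i
    · subst hj; simp [ofEff]
    · simp [ofEff, Function.update_of_ne hj]
  funext a
  simp [effPayoffField, this, payoffField_update]

/-- The product rule, with the payoffs of player `i` constant along the line because only `y_i`
varies. -/
theorem hasLineDerivAt_sqrt_det_mul_effReplicatorField {y : EffProfile m} (hy : y ∈ openCorner m)
    (i : ι) (a : Fin (m i)) :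
    HasLineDerivAt ℝ
      (fun z : EffProfile m => Real.sqrt (playerMetric (z i)).det * G.effReplicatorField z i a)
      (Real.sqrt (playerMetric (y i)).det *
        (-(1 / 2) * ((y i a)⁻¹ - (1 - ∑ b, y i b)⁻¹) * G.effReplicatorField y i a +
          (G.effPayoffField y i a - ∑ b, y i b * G.effPayoffField y i b -
            y i a * G.effPayoffField y i a))) y (Pi.single i (Pi.single a 1)) := by
  have hupd (t : ℝ) : y + t • (Pi.single i (Pi.single a 1) : EffProfile m) =
      Function.update y i (y i + t • Pi.single a 1) := by
    funext j
    by_cases hj : j = i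
    · subst hj; simp
    · simp [Function.update_of_ne hj, Pi.single_eq_of_ne hj]
  have hc (b : Fin (m i)) : HasDerivAt
      (fun t : ℝ => (y i + t • Pi.single a 1 : Fin (m i) → ℝ) b)
      ((Pi.single a 1 : Fin (m i) → ℝ) b) 0 := by
    simpa using
      ((hasDerivAt_id (0 : ℝ)).mul_const ((Pi.single a 1 : Fin (m i) → ℝ) b)).const_add (y i b)
  have hV := (hc a).mul ((HasDerivAt.fun_sum fun b (_ : b ∈ Finset.univ) =>
    (hc b).mul_const (G.effPayoffField y i b)).const_sub (G.effPayoffField y i a))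
  have := (hasDerivAt_sqrt_det_playerMetric (hy i).1 (hy i).2 a).mul hV
  unfold HasLineDerivAt
  simp only [hupd, effReplicatorField, effPayoffField_update, Function.update_self]
  refine this.congr_deriv ?_
  simp [Pi.single_apply]
  ring

theorem sum_payoffField_sub_mixedPayoff (y : EffProfile m) (i : ι) :
    ∑ a, (G.payoffField (ofEff y) i a - G.mixedPayoff i (ofEff y)) =
      ∑ a, (G.effPayoffField y i a - ∑ b, y i b * G.effPayoffField y i b) -
        ∑ b, y i b * G.effPayoffField y i b := by
  have h : G.mixedPayoff i (ofEff y) =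
      G.payoffField (ofEff y) i 0 + ∑ b, y i b * G.effPayoffField y i b := by
    rw [← sum_mul_payoffField, Fin.sum_univ_succ]
    simp only [ofEff, ofEffPlayer, Fin.cons_zero, Fin.cons_succ, effPayoffField, mul_sub,
      Finset.sum_sub_distrib, ← Finset.sum_mul]
    ring
  rw [Fin.sum_univ_succ, h]
  simp only [effPayoffField]
  rw [Finset.sum_congr rfl fun a _ => (sub_sub _ _ _).symm]
  ring

theorem playerDivergence_effReplicatorField {y : EffProfile m} (hy : y ∈ openCorner m) (i : ι) :
    playerDivergence G.effReplicatorField i y =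
      1 / 2 * ∑ a, (G.payoffField (ofEff y) i a - G.mixedPayoff i (ofEff y)) := by
  have h0 : 1 - ∑ b, y i b ≠ 0 := by linarith [(hy i).2]
  have hρ : Real.sqrt (playerMetric (y i)).det ≠ 0 := by
    rw [sqrt_det_playerMetric (hy i).1 (hy i).2]; exact Real.exp_ne_zero _
  rw [playerDivergence, Finset.sum_congr rfl fun a _ =>
    (G.hasLineDerivAt_sqrt_det_mul_effReplicatorField hy i a).lineDeriv, ← Finset.mul_sum,
    ← mul_assoc, one_div_mul_cancel hρ, one_mul, sum_payoffField_sub_mixedPayoff]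
  set v := G.effPayoffField y i
  set S := ∑ b, y i b * v b with hS
  -- Summed over `a`, the middle term gives `S / 2` because `1 - ∑ y` cancels, and the last gives
  -- `-S`; the resulting `-S / 2` is the contribution of action `0`.
  have hterm (a : Fin (m i)) : -(1 / 2) * ((y i a)⁻¹ - (1 - ∑ b, y i b)⁻¹) *
      G.effReplicatorField y i a + (v a - S - y i a * v a) =
      1 / 2 * (v a - S) + 1 / 2 * (1 - ∑ b, y i b)⁻¹ * (y i a * v a - y i a * S) - y i a * v a := by
    have := ((hy i).1 a).ne'
    have hV : G.effReplicatorField y i a = y i a * (v a - S) := rfl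
    rw [hV]
    field_simp
    ring
  simp_rw [hterm]
  rw [Finset.sum_sub_distrib, Finset.sum_add_distrib, ← Finset.mul_sum, ← Finset.mul_sum,
    Finset.sum_sub_distrib (fun a => y i a * v a), ← Finset.sum_mul, ← hS]
  field_simp
  ring

/-! ### Conservation of the coordinate product and of the volume -/

variable {G}

theorem IsIncompressible.sum_payoffField_sub_mixedPayoff_eq_zero (hG : G.IsIncompressible)
    (x : IntStrategies m) : ∑ i, ∑ a, (G.payoffField x.1 i a - G.mixedPayoff i x.1) = 0 := by
  have h := hG _ (toEff_mem_openCorner x)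
  simp_rw [G.playerDivergence_effReplicatorField (toEff_mem_openCorner x), ← Finset.mul_sum,
    ofEff_toEff] at h
  linarith

/-- The replicator dynamics of an incompressible game conserve the product of all coordinates. -/
theorem IsReplicatorFlow.prod_eq {Φ : ℝ → IntStrategies m → IntStrategies m}
    (hΦ : G.IsReplicatorFlow Φ) (hG : G.IsIncompressible) (t : ℝ) (x : IntStrategies m) :
    ∏ i, ∏ a, (Φ t x).1 i a = ∏ i, ∏ a, x.1 i a := by
  have hexp (x : IntStrategies m) :
      ∏ i, ∏ a, x.1 i a = Real.exp (∑ i, ∑ a, Real.log (x.1 i a)) := by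
    simp_rw [Real.exp_sum]
    exact Finset.prod_congr rfl fun i _ => Finset.prod_congr rfl fun a _ =>
      (Real.exp_log ((x.2 i).1 a)).symm
  -- The derivative of the log-product is exactly the sum that incompressibility makes zero.
  have hd (s : ℝ) : HasDerivAt (fun s => ∑ i, ∑ a, Real.log ((Φ s x).1 i a)) 0 s := by
    refine HasDerivAt.congr_deriv ?_ (hG.sum_payoffField_sub_mixedPayoff_eq_zero (Φ s x))
    exact HasDerivAt.fun_sum fun i _ => HasDerivAt.fun_sum fun a _ =>
      G.hasDerivAt_log_of_replicator (x := fun s => Φ s x) (hΦ.solves x s) i a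
  have := is_const_of_deriv_eq_zero (fun s => (hd s).differentiableAt) (fun s => (hd s).deriv) t 0
  rw [hexp, hexp, this, hΦ.start]

theorem IsReplicatorFlow.shahshahaniVolume_image {Φ : ℝ → IntStrategies m → IntStrategies m}
    (hΦ : G.IsReplicatorFlow Φ) (hG : G.IsIncompressible) (t : ℝ) {B : Set (IntStrategies m)}
    (hB : IsOpen B) : shahshahaniVolume (Φ t '' B) = shahshahaniVolume B := by
  obtain ⟨K, L, hK, hL⟩ := G.logField_bounded_lipschitz
  set e := logRatioHomeomorph m
  have hφ := hΦ.isGlobalFlow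
  have hmp := hφ.measurePreserving hK hL G.logField_update t
  set T : EffProfile m ≃ₜ EffProfile m := hφ.homeomorph hL t
  have hT (z : EffProfile m) : T z = e (Φ t (e.symm z)) := rfl
  have himg : e '' (Φ t '' B) = T '' (e '' B) := by
    rw [image_image, image_image]
    exact image_congr fun x _ => by rw [hT, e.symm_apply_apply]
  have hopen : IsOpen (Φ t '' B) := by
    rw [← e.isOpen_image, himg, T.isOpen_image, e.isOpen_image]
    exact hB
  -- Changing variables by the measure-preserving `T` leaves only the density at `T z` to be
  -- compared with that at `z`.
  rw [shahshahaniVolume_eq_setLIntegral hopen, shahshahaniVolume_eq_setLIntegral hB, himg,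
    ← MeasurePreserving.setLIntegral_comp_emb (g := T) hmp T.measurableEmbedding]
  refine lintegral_congr fun z => ?_
  have h1 : softmax (T z) = (Φ t (e.symm z)).1 :=
    congrArg Subtype.val (e.symm_apply_apply (Φ t (e.symm z)))
  rw [h1, hΦ.prod_eq hG]
  rfl

end

end FiniteGame

theorem mainTheorem4 {ι : Type*} [Fintype ι] [DecidableEq ι] {m : ι → ℕ} (G : FiniteGame m)
    (hG : G.IsIncompressible) :
    (∃! Φ : ℝ → FiniteGame.IntStrategies m → FiniteGame.IntStrategies m,
      G.IsReplicatorFlow Φ) ∧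
    ∀ Φ : ℝ → FiniteGame.IntStrategies m → FiniteGame.IntStrategies m,
      G.IsReplicatorFlow Φ →
        ∀ (t : ℝ) (B : Set (FiniteGame.IntStrategies m)), IsOpen B →
          FiniteGame.shahshahaniVolume (Φ t '' B) = FiniteGame.shahshahaniVolume B :=
  ⟨G.existsUnique_isReplicatorFlow, fun _ hΦ t _ hB => hΦ.shahshahaniVolume_image hG t hB⟩
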